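/- Let $m,n,k$ be positive integers and $X\in\mathbb R^{m\times n}$. On $\mathcal X=\mathbb R^{m\times k}\times\mathbb R^{k\times n}$, with the inner product $\langle (G,H),(G',H')\rangle=\operatorname{trace}(G^TG')+\operatorname{trace}(H^TH')$, let $J(W,S)=\tfrac12\|X-WS\|_F^2$. Let $\nabla J$ be its gradient and $\nabla^2J(W,S)\colon\mathcal X\to\mathcal X$ its Hessian map, i.e. the derivative of $\nabla J$ at $(W,S)$, with minimum eigenvalue $\lambda_{\min}(\nabla^2J(W,S))$. Call $(W,S)$ a strict saddle of $J$ if $\nabla J(W,S)=0$ and $\lambda_{\min}(\nabla^2J(W,S))<0$. Let $\mathcal M_0=\{(W,S)\in\mathcal X: W^TW-SS^T=0\}$. Then there exists $\gamma<0$ (depending only on $X$ and $k$) such that $\lambda_{\min}(\nabla^2J(W,S))<\gamma$ for every strict saddle $(W,S)$ of $J$ with $(W,S)\in\mathcal M_0$. -/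

import Mathlib

noncomputable section

namespace MatrixFactorization

/-- The parameter space `ℝ^{m×k} × ℝ^{k×n}` with the inner product
`⟨(G, H), (G', H')⟩ = ⟨G, G'⟩ + ⟨H, H'⟩`, each summand being the entrywise (Frobenius) inner
product of matrices. -/
abbrev Param (m n k : ℕ) : Type :=
  WithLp 2 (EuclideanSpace ℝ (Fin m × Fin k) × EuclideanSpace ℝ (Fin k × Fin n))

/-- The first factor `W` of a point `(W, S)` of the parameter space. -/
def Param.W {m n k : ℕ} (p : Param m n k) : Matrix (Fin m) (Fin k) ℝ :=
  Matrix.of fun i j => p.fst (i, j)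

/-- The second factor `S` of a point `(W, S)` of the parameter space. -/
def Param.S {m n k : ℕ} (p : Param m n k) : Matrix (Fin k) (Fin n) ℝ :=
  Matrix.of fun i j => p.snd (i, j)

/-- The point `(W, S)` of the parameter space. -/
def mk {m n k : ℕ} (W : Matrix (Fin m) (Fin k) ℝ) (S : Matrix (Fin k) (Fin n) ℝ) :
    Param m n k :=
  WithLp.toLp 2 (WithLp.toLp 2 fun ij => W ij.1 ij.2, WithLp.toLp 2 fun ij => S ij.1 ij.2)

@[simp] theorem mk_W {m n k : ℕ} (W : Matrix (Fin m) (Fin k) ℝ) (S : Matrix (Fin k) (Fin n) ℝ) :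
    (mk W S).W = W := rfl

@[simp] theorem mk_S {m n k : ℕ} (W : Matrix (Fin m) (Fin k) ℝ) (S : Matrix (Fin k) (Fin n) ℝ) :
    (mk W S).S = S := rfl

@[simp] theorem mk_eta {m n k : ℕ} (p : Param m n k) : mk p.W p.S = p := rfl

/-- The objective `J(W, S) = ½ ‖X - W S‖_F²`. -/
def J {m n k : ℕ} (X : Matrix (Fin m) (Fin n) ℝ) (p : Param m n k) : ℝ :=
  (1 / 2) * ∑ i, ∑ j, ((X - p.W * p.S) i j) ^ 2

/-- The Hessian map of `f` at `x`: the derivative at `x` of the gradient of `f`. -/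
def hessian {E : Type*} [NormedAddCommGroup E] [InnerProductSpace ℝ E] [CompleteSpace E]
    (f : E → ℝ) (x : E) : E →L[ℝ] E :=
  fderiv ℝ (fun y => gradient f y) x

/-- The minimum eigenvalue of an operator. It is used for symmetric operators on
finite-dimensional spaces, where the infimum is attained
(see `isLeast_minEigenvalue`). -/
def minEigenvalue {E : Type*} [NormedAddCommGroup E] [InnerProductSpace ℝ E]
    (T : E →L[ℝ] E) : ℝ :=
  sInf {μ : ℝ | Module.End.HasEigenvalue (T : E →ₗ[ℝ] E) μ}

theorem isLeast_minEigenvalue {E : Type*} [NormedAddCommGroup E] [InnerProductSpace ℝ E]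
    [FiniteDimensional ℝ E] [Nontrivial E] (T : E →L[ℝ] E)
    (hT : (T : E →ₗ[ℝ] E).IsSymmetric) :
    IsLeast {μ : ℝ | Module.End.HasEigenvalue (T : E →ₗ[ℝ] E) μ} (minEigenvalue T) := by
  have hfin : {μ : ℝ | Module.End.HasEigenvalue (T : E →ₗ[ℝ] E) μ}.Finite :=
    Module.End.finite_hasEigenvalue _
  have hne : {μ : ℝ | Module.End.HasEigenvalue (T : E →ₗ[ℝ] E) μ}.Nonempty :=
    ⟨_, hT.hasEigenvalue_iInf_of_finiteDimensional⟩
  exact ⟨hne.csInf_mem hfin, fun μ hμ => csInf_le hfin.bddBelow hμ⟩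

/-- A strict saddle of `f`: a critical point at which the Hessian has negative minimum
eigenvalue. -/
def IsStrictSaddle {E : Type*} [NormedAddCommGroup E] [InnerProductSpace ℝ E] [CompleteSpace E]
    (f : E → ℝ) (x : E) : Prop :=
  gradient f x = 0 ∧ minEigenvalue (hessian f x) < 0

/-- The set `M_C = {(W, S) : Wᵀ W - S Sᵀ = C}`. -/
def manifoldM {k : ℕ} (m n : ℕ) (C : Matrix (Fin k) (Fin k) ℝ) : Set (Param m n k) :=
  {p | p.W.transpose * p.W - p.S * p.S.transpose = C}

end MatrixFactorization

end

/-! At a balanced critical point put `R = X - W S`; then `R Sᵀ = 0`, `Wᵀ R = 0` and `Wᵀ W = S Sᵀ`.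
The Hessian form in direction `(A, B)` is `‖A S + W B‖² - 2⟨R, A B⟩` (`inner_hessian_J`). Let `s` be
the least eigenvalue of `Wᵀ W` and `t` the largest singular value of `R`.

If `t ≤ s`, the form is nonnegative (`hessianForm_nonneg`), so a strict saddle has `s < t`. With `q`
a unit eigenvector for `s` and `u`, `v` singular vectors of `R` for `t`, the direction `(u qᵀ, q
vᵀ)` has squared norm 2 and form value `2s - 2t`, so the least Hessian eigenvalue is at most `s - t`
(`minEigenvalue_hessian_le`).

Criticality makes `t`, and `s` unless it is zero, singular values of `X`. Hence `s - t` lies in a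
finite set of negative numbers determined by `X`, and any `γ < 0` above that set works. -/

namespace MatrixFactorization

open Matrix

/-! ### Least eigenvalue and quadratic form of a symmetric operator. -/

section Rayleigh

variable {E : Type*} [NormedAddCommGroup E] [InnerProductSpace ℝ E]

/-- Every eigenvalue attains the quadratic form at a unit vector. -/
theorem exists_unit_eigenvector {T : E →ₗ[ℝ] E} {μ : ℝ} (h : Module.End.HasEigenvalue T μ) :
    ∃ x : E, ‖x‖ = 1 ∧ T x = μ • x := by
  obtain ⟨x, hx⟩ := h.exists_hasEigenvector
  have hx0 : ‖x‖ ≠ 0 := norm_ne_zero_iff.mpr hx.2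
  refine ⟨‖x‖⁻¹ • x, by rw [norm_smul, norm_inv, norm_norm, inv_mul_cancel₀ hx0], ?_⟩
  rw [map_smul, hx.apply_eq_smul, smul_comm]

/-- The least eigenvalue of a symmetric operator bounds its quadratic form from below. -/
theorem minEigenvalue_mul_le [FiniteDimensional ℝ E] [Nontrivial E] (T : E →L[ℝ] E)
    (hT : (T : E →ₗ[ℝ] E).IsSymmetric) (x : E) :
    minEigenvalue T * ‖x‖ ^ 2 ≤ inner ℝ (T x) x := by
  have hbdd : BddBelow (Set.range fun y : {y : E // y ≠ 0} => T.rayleighQuotient y) := by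
    refine ⟨-‖T‖, ?_⟩
    rintro _ ⟨y, rfl⟩
    have hy : 0 < ‖(y : E)‖ ^ 2 := by have := norm_pos_iff.mpr y.2; positivity
    have h1 := abs_real_inner_le_norm (T y) (y : E)
    have h2 := T.le_opNorm (y : E)
    simp only [ContinuousLinearMap.rayleighQuotient, ContinuousLinearMap.reApplyInnerSelf_apply,
      RCLike.re_to_real]
    rw [le_div_iff₀ hy]
    nlinarith [neg_abs_le (inner ℝ (T y) (y : E)), norm_nonneg (y : E)]
  have hle : minEigenvalue T ≤ ⨅ y : {y : E // y ≠ 0}, T.rayleighQuotient y :=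
    (isLeast_minEigenvalue T hT).2 hT.hasEigenvalue_iInf_of_finiteDimensional
  rcases eq_or_ne x 0 with rfl | hx
  · simp
  have hx' : 0 < ‖x‖ ^ 2 := by have := norm_pos_iff.mpr hx; positivity
  have h := hle.trans (ciInf_le hbdd ⟨x, hx⟩)
  simpa only [ContinuousLinearMap.rayleighQuotient,
    ContinuousLinearMap.reApplyInnerSelf_apply, RCLike.re_to_real, le_div_iff₀ hx'] using h

/-- On the zero space there are no eigenvalues, and `sInf ∅ = 0` is not negative. -/
theorem nontrivial_of_minEigenvalue_neg {T : E →L[ℝ] E} (h : minEigenvalue T < 0) :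
    Nontrivial E := by
  by_contra hE
  rw [not_nontrivial_iff_subsingleton] at hE
  have : {μ : ℝ | Module.End.HasEigenvalue (T : E →ₗ[ℝ] E) μ} = ∅ := by
    ext μ
    simp only [Set.mem_ofPred_eq, Set.mem_empty_iff_false, iff_false]
    intro hμ
    obtain ⟨x, hx, -⟩ := exists_unit_eigenvector hμ
    simp [Subsingleton.elim x 0] at hx
  simp [minEigenvalue, this] at h

/-- If the least eigenvalue of a symmetric operator is negative, so is its quadratic form
somewhere. -/
theorem exists_inner_neg_of_minEigenvalue_neg [FiniteDimensional ℝ E] {T : E →L[ℝ] E}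
    (hT : (T : E →ₗ[ℝ] E).IsSymmetric) (h : minEigenvalue T < 0) :
    ∃ x, inner ℝ (T x) x < 0 := by
  have := nontrivial_of_minEigenvalue_neg h
  obtain ⟨x, hx, hTx⟩ := exists_unit_eigenvector (isLeast_minEigenvalue T hT).1
  refine ⟨x, ?_⟩
  rw [ContinuousLinearMap.coe_coe] at hTx
  rwa [hTx, real_inner_smul_left, real_inner_self_eq_norm_sq, hx, one_pow, mul_one]

end Rayleigh

/-! ### Frobenius inner product inequalities. -/

section MatrixLemmas

variable {l m n k : ℕ}

/-- The least eigenvalue of a symmetric matrix, with a unit eigenvector. -/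
theorem exists_min_eigenvector [NeZero k] (M : Matrix (Fin k) (Fin k) ℝ) (hM : Mᵀ = M) :
    ∃ (s : ℝ) (q : Fin k → ℝ), q ⬝ᵥ q = 1 ∧ M *ᵥ q = s • q ∧
      ∀ y, s * (y ⬝ᵥ y) ≤ y ⬝ᵥ M *ᵥ y := by
  have hsym : (Matrix.toEuclideanLin M).IsSymmetric :=
    Matrix.isSymmetric_toEuclideanLin_iff.mpr (by
      rw [Matrix.IsHermitian, conjTranspose_eq_transpose_of_trivial, hM])
  set T := LinearMap.toContinuousLinearMap (Matrix.toEuclideanLin M) with hTdef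
  have hT : (T : EuclideanSpace ℝ (Fin k) →ₗ[ℝ] _).IsSymmetric := hsym
  obtain ⟨x, hx, hTx⟩ := exists_unit_eigenvector (isLeast_minEigenvalue T hT).1
  refine ⟨minEigenvalue T, x.ofLp, ?_, ?_, fun y => ?_⟩
  · have := real_inner_self_eq_norm_sq x
    rw [hx, EuclideanSpace.inner_eq_star_dotProduct] at this
    simpa using this
  · exact congrArg WithLp.ofLp hTx
  · have := minEigenvalue_mul_le T hT (WithLp.toLp 2 y)
    rw [← real_inner_self_eq_norm_sq, EuclideanSpace.inner_eq_star_dotProduct,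
      EuclideanSpace.inner_eq_star_dotProduct] at this
    simpa [hTdef] using this

theorem trace_transpose_mul_self_eq_sum_col (M : Matrix (Fin m) (Fin n) ℝ) :
    trace (Mᵀ * M) = ∑ j, M.col j ⬝ᵥ M.col j := rfl

theorem trace_transpose_mul_self_nonneg (M : Matrix (Fin m) (Fin n) ℝ) :
    0 ≤ trace (Mᵀ * M) := by
  rw [trace_transpose_mul_self_eq_sum_col]
  exact Finset.sum_nonneg fun j _ => Finset.sum_nonneg fun i _ => mul_self_nonneg _

theorem mul_trace_le_trace_mul {s : ℝ} {N : Matrix (Fin l) (Fin m) ℝ}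
    (h : ∀ y, s * (y ⬝ᵥ y) ≤ N *ᵥ y ⬝ᵥ N *ᵥ y) (B : Matrix (Fin m) (Fin n) ℝ) :
    s * trace (Bᵀ * B) ≤ trace ((N * B)ᵀ * (N * B)) := by
  rw [trace_transpose_mul_self_eq_sum_col, trace_transpose_mul_self_eq_sum_col, Finset.mul_sum]
  exact Finset.sum_le_sum fun j _ => h (B.col j)

theorem trace_mul_le_mul_trace {s : ℝ} {N : Matrix (Fin l) (Fin m) ℝ}
    (h : ∀ y, N *ᵥ y ⬝ᵥ N *ᵥ y ≤ s * (y ⬝ᵥ y)) (B : Matrix (Fin m) (Fin n) ℝ) :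
    trace ((N * B)ᵀ * (N * B)) ≤ s * trace (Bᵀ * B) := by
  rw [trace_transpose_mul_self_eq_sum_col, trace_transpose_mul_self_eq_sum_col, Finset.mul_sum]
  exact Finset.sum_le_sum fun j _ => h (B.col j)

theorem trace_transpose_mul_comm (A B : Matrix (Fin m) (Fin n) ℝ) :
    trace (Aᵀ * B) = trace (Bᵀ * A) := by
  rw [← trace_transpose, transpose_mul, transpose_transpose]

theorem trace_transpose_mul_self_add (A B : Matrix (Fin m) (Fin n) ℝ) :
    trace ((A + B)ᵀ * (A + B)) = trace (Aᵀ * A) + 2 * trace (Aᵀ * B) + trace (Bᵀ * B) := by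
  simp only [transpose_add, Matrix.add_mul, Matrix.mul_add, trace_add,
    trace_transpose_mul_comm B A]
  ring

/-- Young's inequality, from expanding `‖s A - B‖² ≥ 0`. -/
theorem two_mul_trace_le {s : ℝ} (hs : 0 < s) (A B : Matrix (Fin m) (Fin n) ℝ) :
    2 * trace (Aᵀ * B) ≤ s * trace (Aᵀ * A) + s⁻¹ * trace (Bᵀ * B) := by
  have h := trace_transpose_mul_self_nonneg (s • A + -B)
  rw [trace_transpose_mul_self_add] at h
  simp only [transpose_smul, transpose_neg, Matrix.smul_mul, Matrix.mul_smul, Matrix.mul_neg, Matrix.neg_mul,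
    neg_neg, trace_smul, trace_neg, smul_eq_mul] at h
  have : s * (s * trace (Aᵀ * A) + s⁻¹ * trace (Bᵀ * B) - 2 * trace (Aᵀ * B)) ≥ 0 := by
    have e : s * (s⁻¹ * trace (Bᵀ * B)) = trace (Bᵀ * B) := by field_simp
    rw [mul_sub, mul_add, e]
    linarith
  linarith [nonneg_of_mul_nonneg_right this hs]

end MatrixLemmas

/-- The quadratic form of the Hessian of `J`, with residual `R`, is nonnegative when the residual
is dominated by the smallest eigenvalue of `Wᵀ W = S Sᵀ`. -/
theorem hessianForm_nonneg {m n k : ℕ} {W : Matrix (Fin m) (Fin k) ℝ}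
    {S : Matrix (Fin k) (Fin n) ℝ} {R : Matrix (Fin m) (Fin n) ℝ} {s : ℝ} (hs : 0 ≤ s)
    (hbal : Wᵀ * W = S * Sᵀ) (hRS : R * Sᵀ = 0) (hWR : Wᵀ * R = 0)
    (hW : ∀ y, s * (y ⬝ᵥ y) ≤ W *ᵥ y ⬝ᵥ W *ᵥ y)
    (hR : ∀ y, R *ᵥ y ⬝ᵥ R *ᵥ y ≤ s ^ 2 * (y ⬝ᵥ y))
    (A : Matrix (Fin m) (Fin k) ℝ) (B : Matrix (Fin k) (Fin n) ℝ) :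
    0 ≤ trace ((A * S + W * B)ᵀ * (A * S + W * B)) - 2 * trace (Rᵀ * (A * B)) := by
  -- For `s = 0` the bound on `R` forces `R = 0`, leaving a square.
  rcases hs.eq_or_lt with rfl | hs
  · have : R = 0 := by
      refine ext_of_mulVec_single fun i => ?_
      rw [zero_mulVec]
      have h := hR (Pi.single i 1)
      rw [zero_pow two_ne_zero, zero_mul] at h
      exact dotProduct_self_eq_zero.mp (le_antisymm h
        (Finset.sum_nonneg fun i _ => mul_self_nonneg _))
    simpa [this] using trace_transpose_mul_self_nonneg (A * S + W * B)
  have hdet : IsUnit (Wᵀ * W).det := by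
    rw [isUnit_iff_ne_zero]
    intro h0
    obtain ⟨y, hy, hy0⟩ := exists_mulVec_eq_zero_iff.mpr h0
    have h := hW y
    have e : W *ᵥ y ⬝ᵥ W *ᵥ y = 0 := by
      rw [dotProduct_mulVec, ← mulVec_transpose, mulVec_mulVec, hy0, zero_dotProduct]
    have hpos : 0 < y ⬝ᵥ y := lt_of_le_of_ne
      (Finset.sum_nonneg fun i _ => mul_self_nonneg _)
      fun h => hy (dotProduct_self_eq_zero.mp h.symm)
    nlinarith
  -- Project the columns of `A` onto the column space of `W`; below, the rows of `B` onto the row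
  -- space of `S`.
  obtain ⟨A', C, rfl, hA'⟩ : ∃ (A' : Matrix (Fin m) (Fin k) ℝ) (C : Matrix (Fin k) (Fin k) ℝ), A = A' + W * C ∧ Wᵀ * A' = 0 := by
    refine ⟨A - W * ((Wᵀ * W)⁻¹ * (Wᵀ * A)), (Wᵀ * W)⁻¹ * (Wᵀ * A), by simp, ?_⟩
    rw [Matrix.mul_sub, ← Matrix.mul_assoc Wᵀ W, ← Matrix.mul_assoc (Wᵀ * W), mul_nonsing_inv _ hdet,
      Matrix.one_mul, sub_self]
  rw [hbal] at hdet
  obtain ⟨B', D, rfl, hB'⟩ : ∃ (B' : Matrix (Fin k) (Fin n) ℝ) (D : Matrix (Fin k) (Fin k) ℝ), B = B' + D * S ∧ B' * Sᵀ = 0 := by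
    refine ⟨B - (B * Sᵀ) * (S * Sᵀ)⁻¹ * S, (B * Sᵀ) * (S * Sᵀ)⁻¹, by simp, ?_⟩
    rw [Matrix.sub_mul, Matrix.mul_assoc _ S, Matrix.mul_assoc _ _ (S * Sᵀ),
      nonsing_inv_mul _ hdet, Matrix.mul_one, sub_self]
  have hA'' : A'ᵀ * W = 0 := by
    rw [← transpose_transpose (A'ᵀ * W), transpose_mul, transpose_transpose, hA', transpose_zero]
  have hB'' : S * B'ᵀ = 0 := by
    rw [← transpose_transpose (S * B'ᵀ), transpose_mul, transpose_transpose, hB', transpose_zero]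
  have hRW : Rᵀ * W = 0 := by
    rw [← transpose_transpose (Rᵀ * W), transpose_mul, transpose_transpose, hWR, transpose_zero]
  have hSR : S * Rᵀ = 0 := by
    rw [← transpose_transpose (S * Rᵀ), transpose_mul, transpose_transpose, hRS, transpose_zero]
  -- The three summands are pairwise orthogonal, and by criticality `R` sees only `A'` and `B'`.
  have hsum : (A' + W * C) * S + W * (B' + D * S) =
      A' * S + (W * B' + W * ((C + D) * S)) := by
    simp only [Matrix.add_mul, Matrix.mul_add, Matrix.mul_assoc]
    abel
  have h1 : trace ((A' * S)ᵀ * (W * B' + W * ((C + D) * S))) = 0 := by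
    rw [← Matrix.mul_add, transpose_mul, Matrix.mul_assoc, ← Matrix.mul_assoc A'ᵀ, hA'',
      Matrix.zero_mul, Matrix.mul_zero, trace_zero]
  have h2 : trace ((W * B')ᵀ * (W * ((C + D) * S))) = 0 := by
    rw [trace_mul_comm, transpose_mul, ← Matrix.mul_assoc W, Matrix.mul_assoc _ S,
      ← Matrix.mul_assoc S, hB'', Matrix.zero_mul, Matrix.mul_zero, trace_zero]
  have h3 : trace (Rᵀ * ((A' + W * C) * (B' + D * S))) = trace ((A')ᵀ * (R * B'ᵀ)) := by
    have e : Rᵀ * ((A' + W * C) * (B' + D * S)) = Rᵀ * A' * B' + Rᵀ * A' * D * S := by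
      rw [← Matrix.mul_assoc, Matrix.mul_add Rᵀ, ← Matrix.mul_assoc Rᵀ W, hRW, Matrix.zero_mul,
        add_zero, Matrix.mul_add, ← Matrix.mul_assoc]
    rw [e, trace_add, trace_mul_comm (Rᵀ * A' * D), Matrix.mul_assoc, ← Matrix.mul_assoc S,
      ← Matrix.mul_assoc S, hSR, Matrix.zero_mul, Matrix.zero_mul, trace_zero, add_zero,
      ← trace_transpose, transpose_mul, transpose_mul, transpose_transpose,
      Matrix.mul_assoc, trace_mul_comm, Matrix.mul_assoc]
  have hS : ∀ y, s * (y ⬝ᵥ y) ≤ Sᵀ *ᵥ y ⬝ᵥ Sᵀ *ᵥ y := fun y => by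
    have h := hW y
    rwa [dotProduct_mulVec, ← mulVec_transpose, mulVec_mulVec, hbal, ← mulVec_mulVec,
      ← transpose_transpose S, mulVec_transpose, ← dotProduct_mulVec, transpose_transpose] at h
  have h4 := mul_trace_le_trace_mul hW B'
  have h5 := mul_trace_le_trace_mul hS A'ᵀ
  have h6 := trace_mul_le_mul_trace hR B'ᵀ
  -- Weight `s` balances the cross term: it is at most `s‖A'‖² + s‖B'‖²`, which `‖A' S‖² + ‖W B'‖²`
  -- absorbs.
  have h7 := two_mul_trace_le hs A' (R * B'ᵀ)
  have h8 := trace_transpose_mul_self_nonneg (W * ((C + D) * S))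
  rw [transpose_transpose, trace_mul_comm A', ← transpose_mul, transpose_transpose,
    trace_mul_comm (A' * S)] at h5
  rw [transpose_transpose, trace_mul_comm B'] at h6
  have h9 : s⁻¹ * trace ((R * B'ᵀ)ᵀ * (R * B'ᵀ)) ≤ s * trace (B'ᵀ * B') := by
    rw [inv_mul_le_iff₀ hs, ← mul_assoc, ← pow_two]
    exact h6
  rw [hsum, h3, trace_transpose_mul_self_add, trace_transpose_mul_self_add, h1, h2]
  linarith

/-! ### Gradient and Hessian of `J`. -/

section Derivatives

variable {m n k : ℕ}

theorem inner_mk (A A' : Matrix (Fin m) (Fin k) ℝ) (B B' : Matrix (Fin k) (Fin n) ℝ) :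
    inner ℝ (mk A B) (mk A' B') = trace (Aᵀ * A') + trace (Bᵀ * B') := by
  simp only [mk, WithLp.prod_inner_apply, EuclideanSpace.inner_eq_star_dotProduct, star_trivial]
  congr 1
  · simp [dotProduct, trace, mul_apply, Fintype.sum_prod_type_right, mul_comm]
  · simp [dotProduct, trace, mul_apply, Fintype.sum_prod_type_right, mul_comm]

theorem mk_add (A A' : Matrix (Fin m) (Fin k) ℝ) (B B' : Matrix (Fin k) (Fin n) ℝ) :
    mk A B + mk A' B' = mk (A + A') (B + B') := rfl

theorem smul_mk (c : ℝ) (A : Matrix (Fin m) (Fin k) ℝ) (B : Matrix (Fin k) (Fin n) ℝ) :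
    c • mk A B = mk (c • A) (c • B) := rfl

theorem J_mk (X : Matrix (Fin m) (Fin n) ℝ) (W : Matrix (Fin m) (Fin k) ℝ)
    (S : Matrix (Fin k) (Fin n) ℝ) :
    J X (mk W S) = 1 / 2 * trace ((X - W * S)ᵀ * (X - W * S)) := by
  rw [J, mk_W, mk_S, Finset.sum_comm]
  simp only [trace, diag_apply, mul_apply, transpose_apply, pow_two]

/-- The gradient of `J` in closed form. -/
def gradJ (X : Matrix (Fin m) (Fin n) ℝ) (p : Param m n k) : Param m n k :=
  mk (-((X - p.W * p.S) * p.Sᵀ)) (-(p.Wᵀ * (X - p.W * p.S)))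

theorem differentiable_W_apply (i : Fin m) (j : Fin k) :
    Differentiable ℝ (fun p : Param m n k => p.W i j) :=
  ((EuclideanSpace.proj (𝕜 := ℝ) (i, j)).comp (WithLp.fstL 2 ℝ _ _)).differentiable

theorem differentiable_S_apply (i : Fin k) (j : Fin n) :
    Differentiable ℝ (fun p : Param m n k => p.S i j) :=
  ((EuclideanSpace.proj (𝕜 := ℝ) (i, j)).comp (WithLp.sndL 2 ℝ _ _)).differentiable

theorem differentiable_mk {E : Type*} [NormedAddCommGroup E] [NormedSpace ℝ E]
    {A : E → Matrix (Fin m) (Fin k) ℝ} {B : E → Matrix (Fin k) (Fin n) ℝ}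
    (hA : ∀ i j, Differentiable ℝ fun x => A x i j)
    (hB : ∀ i j, Differentiable ℝ fun x => B x i j) :
    Differentiable ℝ fun x => mk (A x) (B x) := by
  have h : Differentiable ℝ fun x =>
      ((WithLp.toLp 2 fun ij => A x ij.1 ij.2 : EuclideanSpace ℝ (Fin m × Fin k)),
        (WithLp.toLp 2 fun ij => B x ij.1 ij.2 : EuclideanSpace ℝ (Fin k × Fin n))) :=
    (differentiable_euclidean.mpr fun ij => hA ij.1 ij.2).prodMk
      (differentiable_euclidean.mpr fun ij => hB ij.1 ij.2)
  exact (WithLp.prodContinuousLinearEquiv 2 ℝ (EuclideanSpace ℝ (Fin m × Fin k))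
    (EuclideanSpace ℝ (Fin k × Fin n))).symm.differentiable.comp h

theorem differentiable_J (X : Matrix (Fin m) (Fin n) ℝ) :
    Differentiable ℝ (J (k := k) X) := by
  have hW := differentiable_W_apply (m := m) (n := n) (k := k)
  have hS := differentiable_S_apply (m := m) (n := n) (k := k)
  unfold J
  simp only [Matrix.sub_apply, mul_apply]
  fun_prop

theorem differentiable_gradJ (X : Matrix (Fin m) (Fin n) ℝ) :
    Differentiable ℝ (gradJ (k := k) X) := by
  have hW := differentiable_W_apply (m := m) (n := n) (k := k)
  have hS := differentiable_S_apply (m := m) (n := n) (k := k)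
  refine differentiable_mk (fun i j => ?_) fun i j => ?_ <;>
  · simp only [Matrix.sub_apply, mul_apply, Matrix.neg_apply, transpose_apply]
    fun_prop

/-- The derivative of a function that is polynomial along a line. -/
theorem fderiv_apply_of_line {E F : Type*} [NormedAddCommGroup E] [NormedSpace ℝ E]
    [NormedAddCommGroup F] [NormedSpace ℝ F] {f : E → F} {x v : E}
    (hf : DifferentiableAt ℝ f x) {a b c d e : F}
    (h : ∀ t : ℝ, f (x + t • v) = a + t • b + t ^ 2 • c + t ^ 3 • d + t ^ 4 • e) :
    fderiv ℝ f x v = b := by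
  rw [← hf.lineDeriv_eq_fderiv, lineDeriv, funext h]
  have hp (n : ℕ) (w : F) : HasDerivAt (fun t : ℝ => t ^ n • w) ((n * (0 : ℝ) ^ (n - 1)) • w) 0 :=
    (hasDerivAt_pow n 0).smul_const w
  have := (((((hasDerivAt_const (0 : ℝ) a).add ((hasDerivAt_id (0 : ℝ)).smul_const b)).add
    (hp 2 c)).add (hp 3 d)).add (hp 4 e)).deriv
  simp only [zero_add, one_smul, ne_eq, OfNat.ofNat_ne_zero, not_false_eq_true, Nat.cast_ofNat,
    Nat.add_one_sub_one, zero_pow, pow_one, mul_zero, zero_smul, add_zero] at this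
  exact this

theorem gradient_J (X : Matrix (Fin m) (Fin n) ℝ) (p : Param m n k) :
    gradient (J X) p = gradJ X p := by
  refine ext_inner_right ℝ fun v => ?_
  rw [gradient, InnerProductSpace.toDual_symm_apply]
  obtain ⟨W, S, rfl⟩ : ∃ W S, p = mk W S := ⟨p.W, p.S, rfl⟩
  obtain ⟨A, B, rfl⟩ : ∃ A B, v = mk A B := ⟨v.W, v.S, rfl⟩
  set R := X - W * S with hR
  -- Coefficients of `½‖R - t L - t² N‖²` with `L = A S + W B` and `N = A B`.
  refine fderiv_apply_of_line (differentiable_J X _) (a := 1 / 2 * trace (Rᵀ * R))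
    (c := 1 / 2 * trace ((A * S + W * B)ᵀ * (A * S + W * B)) - trace (Rᵀ * (A * B)))
    (d := trace ((A * S + W * B)ᵀ * (A * B)))
    (e := 1 / 2 * trace ((A * B)ᵀ * (A * B))) (fun t => ?_)
  have e : X - (W + t • A) * (S + t • B) = R - t • (A * S + W * B) - t ^ 2 • (A * B) := by
    simp only [hR, Matrix.add_mul, Matrix.mul_add, Matrix.smul_mul, Matrix.mul_smul, smul_add,
      smul_smul, pow_two]
    abel
  have e2 : inner ℝ (gradJ X (mk W S)) (mk A B) = -trace (Rᵀ * (A * S + W * B)) := by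
    rw [gradJ, inner_mk, mk_W, mk_S, ← hR, Matrix.mul_add, trace_add]
    simp only [transpose_neg, transpose_mul, transpose_transpose, Matrix.neg_mul, trace_neg]
    rw [Matrix.mul_assoc S, trace_mul_comm S, ← Matrix.mul_assoc, ← Matrix.mul_assoc]
    simp only [Matrix.mul_assoc]
    ring
  rw [e2, smul_mk, mk_add, J_mk, e]
  set L := A * S + W * B
  set N := A * B
  simp only [transpose_sub, transpose_smul, Matrix.sub_mul, Matrix.mul_sub, Matrix.smul_mul,
    Matrix.mul_smul, trace_sub, trace_smul, smul_eq_mul, trace_transpose_mul_comm L R,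
    trace_transpose_mul_comm N R, trace_transpose_mul_comm N L]
  ring

theorem hessian_J (X : Matrix (Fin m) (Fin n) ℝ) (W A : Matrix (Fin m) (Fin k) ℝ)
    (S B : Matrix (Fin k) (Fin n) ℝ) :
    hessian (J X) (mk W S) (mk A B) =
      mk ((A * S + W * B) * Sᵀ - (X - W * S) * Bᵀ)
        (Wᵀ * (A * S + W * B) - Aᵀ * (X - W * S)) := by
  rw [hessian, funext (gradient_J X)]
  set R := X - W * S with hR
  refine fderiv_apply_of_line (differentiable_gradJ X _)
    (a := mk (-(R * Sᵀ)) (-(Wᵀ * R)))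
    (c := mk ((A * S + W * B) * Bᵀ + A * B * Sᵀ) (Aᵀ * (A * S + W * B) + Wᵀ * (A * B)))
    (d := mk (A * B * Bᵀ) (Aᵀ * (A * B))) (e := 0) (fun t => ?_)
  have e : X - (W + t • A) * (S + t • B) = R - t • (A * S + W * B) - t ^ 2 • (A * B) := by
    simp only [hR, Matrix.add_mul, Matrix.mul_add, Matrix.smul_mul, Matrix.mul_smul, smul_add,
      smul_smul, pow_two]
    abel
  rw [smul_zero, add_zero]
  simp only [smul_mk, mk_add, gradJ, mk_W, mk_S, e]
  set L := A * S + W * B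
  congr 1 <;>
  · simp only [transpose_add, transpose_smul, Matrix.sub_mul, Matrix.mul_sub, Matrix.add_mul,
      Matrix.mul_add, Matrix.smul_mul, Matrix.mul_smul, Matrix.mul_assoc]
    module

/-- Exchanging the two directions only swaps the residual terms, which gives symmetry. -/
theorem inner_hessian_J (X : Matrix (Fin m) (Fin n) ℝ) (W A A' : Matrix (Fin m) (Fin k) ℝ)
    (S B B' : Matrix (Fin k) (Fin n) ℝ) :
    inner ℝ (hessian (J X) (mk W S) (mk A B)) (mk A' B') =
      trace ((A * S + W * B)ᵀ * (A' * S + W * B')) -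
        trace ((X - W * S)ᵀ * (A' * B)) - trace ((X - W * S)ᵀ * (A * B')) := by
  rw [hessian_J, inner_mk]
  set R := X - W * S
  set L := A * S + W * B
  simp only [transpose_sub, transpose_mul L, transpose_mul R, transpose_mul _ L,
    transpose_mul _ R, transpose_transpose, Matrix.sub_mul,
    Matrix.mul_add, trace_sub, trace_add]
  rw [Matrix.mul_assoc S, trace_mul_comm S, Matrix.mul_assoc B, trace_mul_comm B]
  simp only [Matrix.mul_assoc]
  ring

theorem isSymmetric_hessian_J (X : Matrix (Fin m) (Fin n) ℝ) (p : Param m n k) :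
    (hessian (J X) p : Param m n k →ₗ[ℝ] Param m n k).IsSymmetric := by
  intro v w
  obtain ⟨W, S, rfl⟩ : ∃ W S, p = mk W S := ⟨p.W, p.S, rfl⟩
  obtain ⟨A, B, rfl⟩ : ∃ A B, v = mk A B := ⟨v.W, v.S, rfl⟩
  obtain ⟨A', B', rfl⟩ : ∃ A B, w = mk A B := ⟨w.W, w.S, rfl⟩
  rw [ContinuousLinearMap.coe_coe, real_inner_comm _ (mk A B), inner_hessian_J, inner_hessian_J,
    trace_transpose_mul_comm]
  ring

end Derivatives

/-! ### Singular vectors and rank-one matrices. -/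

section Spectrum

variable {m n k : ℕ}

theorem dotProduct_mulVec_transpose_mul_self (N : Matrix (Fin m) (Fin n) ℝ) (y : Fin n → ℝ) :
    y ⬝ᵥ (Nᵀ * N) *ᵥ y = N *ᵥ y ⬝ᵥ N *ᵥ y := by
  rw [← mulVec_mulVec, dotProduct_mulVec, vecMul_transpose]

theorem trace_transpose_vecMulVec_mul (a c : Fin m → ℝ) (b d : Fin n → ℝ) :
    trace ((vecMulVec a b)ᵀ * vecMulVec c d) = a ⬝ᵥ c * (b ⬝ᵥ d) := by
  simp only [trace, diag_apply, mul_apply, transpose_apply, vecMulVec_apply, dotProduct,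
    Finset.sum_mul_sum]
  rw [Finset.sum_comm]
  exact Finset.sum_congr rfl fun i _ => Finset.sum_congr rfl fun j _ => by ring

/-- A matrix violating a norm bound has a singular vector for a singular value exceeding it. -/
theorem exists_singular_vector {R : Matrix (Fin m) (Fin n) ℝ} {s : ℝ}
    (hR : ¬ ∀ y, R *ᵥ y ⬝ᵥ R *ᵥ y ≤ s ^ 2 * (y ⬝ᵥ y)) :
    ∃ (t : ℝ) (v : Fin n → ℝ), s < t ∧ v ⬝ᵥ v = 1 ∧ (Rᵀ * R) *ᵥ v = t ^ 2 • v := by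
  push Not at hR
  obtain ⟨y, hy⟩ := hR
  have : NeZero n := ⟨by rintro rfl; simp [dotProduct, mulVec] at hy⟩
  -- The least eigenvalue of `-RᵀR` is minus the largest squared singular value of `R`.
  obtain ⟨a, v, hv, hav, hmin⟩ := exists_min_eigenvector (-(Rᵀ * R)) (by simp)
  have h1 := hmin y
  rw [neg_mulVec, dotProduct_neg, dotProduct_mulVec_transpose_mul_self] at h1
  have hy0 : 0 ≤ y ⬝ᵥ y := Finset.sum_nonneg fun i _ => mul_self_nonneg _
  have ha : s ^ 2 < -a := by
    by_contra h
    nlinarith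
  refine ⟨√(-a), v, Real.lt_sqrt_of_sq_lt ha, hv, ?_⟩
  rw [Real.sq_sqrt ((sq_nonneg s).trans ha.le), neg_smul, ← hav, neg_mulVec, neg_neg]

theorem hasEigenvalue_toLin' {M : Matrix (Fin n) (Fin n) ℝ} {μ : ℝ} {v : Fin n → ℝ}
    (hv : v ≠ 0) (h : M *ᵥ v = μ • v) : Module.End.HasEigenvalue (Matrix.toLin' M) μ :=
  Module.End.hasEigenvalue_of_hasEigenvector
    (Module.End.hasEigenvector_iff.mpr ⟨Module.End.mem_eigenspace_iff.mpr h, hv⟩)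

end Spectrum

/-! ### Balanced critical points and the singular values of `X`. -/

section CriticalPoint

variable {m n k : ℕ} {X : Matrix (Fin m) (Fin n) ℝ} {W : Matrix (Fin m) (Fin k) ℝ}
  {S : Matrix (Fin k) (Fin n) ℝ}

theorem critical_iff : gradient (J X) (mk W S) = 0 ↔
    (X - W * S) * Sᵀ = 0 ∧ Wᵀ * (X - W * S) = 0 := by
  rw [gradient_J, gradJ, mk_W, mk_S]
  constructor
  · intro h
    exact ⟨neg_eq_zero.mp (congrArg Param.W h), neg_eq_zero.mp (congrArg Param.S h)⟩
  · rintro ⟨h1, h2⟩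
    rw [h1, h2, neg_zero, neg_zero]
    rfl

/-- A nonzero eigenvalue of `Wᵀ W` at a balanced critical point is a singular value of `X`. -/
theorem eigenvalue_sq_of_balanced (hbal : Wᵀ * W = S * Sᵀ) (hRS : (X - W * S) * Sᵀ = 0)
    (hWR : Wᵀ * (X - W * S) = 0) {s : ℝ} {q : Fin k → ℝ} (hq : q ≠ 0) (hs : s ≠ 0)
    (h : (Wᵀ * W) *ᵥ q = s • q) : Module.End.HasEigenvalue (Matrix.toLin' (Xᵀ * X)) (s ^ 2) := by
  have hX : X * Sᵀ = W * (S * Sᵀ) := by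
    rw [Matrix.sub_mul, sub_eq_zero, Matrix.mul_assoc] at hRS
    exact hRS
  have hX' : Xᵀ * W = Sᵀ * (Wᵀ * W) := by
    rw [Matrix.mul_sub, sub_eq_zero] at hWR
    have := congrArg transpose hWR
    simpa [transpose_mul, Matrix.mul_assoc] using this
  have hSS : S *ᵥ (Sᵀ *ᵥ q) = s • q := by rw [mulVec_mulVec, ← hbal, h]
  -- `XᵀX Sᵀq = XᵀW(WᵀW)q = s XᵀW q = s Sᵀ(WᵀW)q = s² Sᵀq`.
  refine hasEigenvalue_toLin' (v := Sᵀ *ᵥ q) (fun h0 => ?_) ?_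
  · rw [h0, mulVec_zero] at hSS
    exact smul_ne_zero hs hq hSS.symm
  · rw [← mulVec_mulVec, mulVec_mulVec q, hX, ← hbal, ← mulVec_mulVec, h, mulVec_smul,
      mulVec_smul, mulVec_mulVec, hX', ← mulVec_mulVec, h, mulVec_smul, smul_smul, pow_two]

/-- A nonzero singular value of the residual at a critical point is a singular value of `X`. -/
theorem eigenvalue_of_residual (hRS : (X - W * S) * Sᵀ = 0)
    (hWR : Wᵀ * (X - W * S) = 0) {t : ℝ} {v : Fin n → ℝ} (hv : v ≠ 0) (ht : t ≠ 0)
    (h : ((X - W * S)ᵀ * (X - W * S)) *ᵥ v = t • v) :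
    S *ᵥ v = 0 ∧ Module.End.HasEigenvalue (Matrix.toLin' (Xᵀ * X)) t := by
  have hSR : S * (X - W * S)ᵀ = 0 := by
    simpa only [transpose_mul, transpose_transpose, transpose_zero] using congrArg transpose hRS
  have hSv : S *ᵥ v = 0 := by
    have h0 : S *ᵥ (t • v) = 0 := by
      rw [← h, mulVec_mulVec, ← Matrix.mul_assoc, hSR, Matrix.zero_mul, zero_mulVec]
    rw [mulVec_smul] at h0
    exact (smul_eq_zero.mp h0).resolve_left ht
  refine ⟨hSv, hasEigenvalue_toLin' hv ?_⟩
  rw [← h]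
  set R := X - W * S with hR
  have hX : X = R + W * S := by rw [hR, sub_add_cancel]
  -- Every term other than `RᵀR` ends in `S`, which kills `v`.
  have e : Xᵀ * X = Rᵀ * R + (Rᵀ * W + (W * S)ᵀ * W) * S := by
    have : (W * S)ᵀ * R = 0 := by rw [transpose_mul, Matrix.mul_assoc, hWR, Matrix.mul_zero]
    rw [hX, transpose_add, Matrix.mul_add, Matrix.add_mul, this, add_zero, ← Matrix.mul_assoc,
      ← Matrix.add_mul, Matrix.add_mul (Rᵀ), ← Matrix.add_mul]
  rw [e, add_mulVec, ← mulVec_mulVec v _ S, hSv, mulVec_zero, add_zero]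

/-- A descent direction pairing an eigenvector of `Wᵀ W` with singular vectors of the residual. -/
theorem minEigenvalue_hessian_le (hbal : Wᵀ * W = S * Sᵀ)
    (hWR : Wᵀ * (X - W * S) = 0) {s t : ℝ} {q : Fin k → ℝ}
    {v : Fin n → ℝ} (hq : q ⬝ᵥ q = 1) (hv : v ⬝ᵥ v = 1) (ht : t ≠ 0)
    (hsq : (Wᵀ * W) *ᵥ q = s • q)
    (htv : ((X - W * S)ᵀ * (X - W * S)) *ᵥ v = t ^ 2 • v) :
    minEigenvalue (hessian (J X) (mk W S)) ≤ s - t := by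
  set R := X - W * S with hR
  set u := t⁻¹ • R *ᵥ v with hu
  have hRv : R *ᵥ v = t • u := by rw [hu, smul_smul, mul_inv_cancel₀ ht, one_smul]
  have huu : u ⬝ᵥ u = 1 := by
    rw [hu, smul_dotProduct, dotProduct_smul, ← dotProduct_mulVec_transpose_mul_self, htv,
      dotProduct_smul, hv]
    simp only [smul_eq_mul]
    field_simp
  have hWu : Wᵀ *ᵥ u = 0 := by
    rw [hu, mulVec_smul, mulVec_mulVec, hWR, zero_mulVec, smul_zero]
  have huW : u ⬝ᵥ W *ᵥ q = 0 := by
    rw [dotProduct_mulVec, ← mulVec_transpose, hWu, zero_dotProduct]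
  have hWq : W *ᵥ q ⬝ᵥ W *ᵥ q = s := by
    rw [← dotProduct_mulVec_transpose_mul_self, hsq, dotProduct_smul, hq, smul_eq_mul, mul_one]
  have hSq : Sᵀ *ᵥ q ⬝ᵥ Sᵀ *ᵥ q = s := by
    rw [← dotProduct_mulVec_transpose_mul_self, transpose_transpose, ← hbal, hsq,
      dotProduct_smul, hq, smul_eq_mul, mul_one]
  have hnorm : ‖mk (vecMulVec u q) (vecMulVec q v)‖ ^ 2 = 2 := by
    rw [← real_inner_self_eq_norm_sq, inner_mk]
    rw [trace_transpose_vecMulVec_mul, trace_transpose_vecMulVec_mul, hq, hv, huu]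
    norm_num
  have : Nontrivial (Param m n k) := by
    refine ⟨mk (vecMulVec u q) (vecMulVec q v), 0, fun h => ?_⟩
    rw [h] at hnorm
    norm_num at hnorm
  have hle := minEigenvalue_mul_le _ (isSymmetric_hessian_J X (mk W S))
    (mk (vecMulVec u q) (vecMulVec q v))
  have hRuv : trace (Rᵀ * (vecMulVec u q * vecMulVec q v)) = t := by
    rw [vecMulVec_mul_vecMulVec, hq, one_smul, mul_vecMulVec, trace_vecMulVec,
      mulVec_transpose, ← dotProduct_mulVec, hRv, dotProduct_smul, huu, smul_eq_mul, mul_one]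
  have hL : trace ((vecMulVec u q * S + W * vecMulVec q v)ᵀ *
      (vecMulVec u q * S + W * vecMulVec q v)) = 2 * s := by
    rw [trace_transpose_mul_self_add, vecMulVec_mul _ _ S, mul_vecMulVec W, ← mulVec_transpose S]
    simp only [trace_transpose_vecMulVec_mul, hv, huu, hWq, hSq, huW]
    ring
  rw [hnorm, inner_hessian_J, hL, ← hR, hRuv] at hle
  linarith

/-- At a balanced strict saddle the least Hessian eigenvalue is bounded above by a negative
difference of numbers that are singular values of `X` or zero. -/
theorem exists_minEigenvalue_le_sqrt_sub_sqrt (hbal : Wᵀ * W = S * Sᵀ)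
    (h : IsStrictSaddle (J X) (mk W S)) :
    ∃ a ∈ insert 0 {μ : ℝ | Module.End.HasEigenvalue (Matrix.toLin' (Xᵀ * X)) μ},
    ∃ b ∈ {μ : ℝ | Module.End.HasEigenvalue (Matrix.toLin' (Xᵀ * X)) μ},
      √a - √b < 0 ∧ minEigenvalue (hessian (J X) (mk W S)) ≤ √a - √b := by
  obtain ⟨hcrit, hneg⟩ := h
  obtain ⟨hRS, hWR⟩ := critical_iff.mp hcrit
  obtain ⟨x, hx⟩ := exists_inner_neg_of_minEigenvalue_neg (isSymmetric_hessian_J X _) hneg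
  obtain ⟨A, B, rfl⟩ : ∃ A B, x = mk A B := ⟨x.W, x.S, rfl⟩
  rw [inner_hessian_J] at hx
  -- For `k = 0` all directions vanish, so the form cannot be negative.
  have : NeZero k := ⟨by
    rintro rfl
    rw [Subsingleton.elim A 0, Subsingleton.elim B 0] at hx
    simp at hx⟩
  obtain ⟨s, q, hq, hsq, hmin⟩ := exists_min_eigenvector (Wᵀ * W) (by simp)
  have hs : 0 ≤ s := by
    have h1 := dotProduct_mulVec_transpose_mul_self W q
    rw [hsq, dotProduct_smul, hq, smul_eq_mul, mul_one] at h1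
    rw [h1]
    exact Finset.sum_nonneg fun i _ => mul_self_nonneg _
  simp only [dotProduct_mulVec_transpose_mul_self] at hmin
  by_cases hR : ∀ y, (X - W * S) *ᵥ y ⬝ᵥ (X - W * S) *ᵥ y ≤ s ^ 2 * (y ⬝ᵥ y)
  · have := hessianForm_nonneg hs hbal hRS hWR hmin hR A B
    linarith
  obtain ⟨t, v, hst, hv, htv⟩ := exists_singular_vector hR
  have ht : 0 < t := hs.trans_lt hst
  have hv0 : v ≠ 0 := by rintro rfl; simp at hv
  have hq0 : q ≠ 0 := by rintro rfl; simp at hq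
  refine ⟨s ^ 2, ?_, t ^ 2, (eigenvalue_of_residual hRS hWR hv0 (pow_pos ht 2).ne' htv).2, ?_⟩
  -- When `Wᵀ W` is singular, `s = 0` need not come from `X`; this is why 0 is inserted.
  · rcases eq_or_ne s 0 with rfl | hs0
    · left
      simp
    · right
      exact eigenvalue_sq_of_balanced hbal hRS hWR hq0 hs0 hsq
  · rw [Real.sqrt_sq hs, Real.sqrt_sq ht.le]
    exact ⟨sub_neg.mpr hst, minEigenvalue_hessian_le hbal hWR hq hv ht.ne' hsq htv⟩

end CriticalPoint

/-- Each `d < 0` lies below all `γ < 0` close enough to 0, and finitely many such conditions hold at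
once. -/
theorem exists_neg_gt_of_finite {D : Set ℝ} (hD : D.Finite) (hneg : ∀ d ∈ D, d < 0) :
    ∃ γ < 0, ∀ d ∈ D, d < γ := by
  have h : ∀ᶠ γ in nhdsWithin (0 : ℝ) (Set.Iio 0), ∀ d ∈ D, d < γ :=
    (Filter.eventually_all_finite hD).mpr fun d hd =>
      Filter.mem_of_superset (Ioo_mem_nhdsLT (hneg d hd)) fun _ hx => hx.1
  obtain ⟨γ, h1, h2⟩ := (h.and self_mem_nhdsWithin).exists
  exact ⟨γ, h2, h1⟩

end MatrixFactorization

theorem mainTheorem2 (m n k : ℕ) (X : Matrix (Fin m) (Fin n) ℝ) :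
    ∃ γ : ℝ, γ < 0 ∧
      ∀ (W : Matrix (Fin m) (Fin k) ℝ) (S : Matrix (Fin k) (Fin n) ℝ),
        MatrixFactorization.mk W S ∈
            MatrixFactorization.manifoldM m n (0 : Matrix (Fin k) (Fin k) ℝ) →
        MatrixFactorization.IsStrictSaddle (MatrixFactorization.J X)
            (MatrixFactorization.mk W S) →
        MatrixFactorization.minEigenvalue
            (MatrixFactorization.hessian (MatrixFactorization.J X)
              (MatrixFactorization.mk W S)) < γ := by
  set F : Set ℝ := insert 0 {μ | Module.End.HasEigenvalue (Matrix.toLin' (X.transpose * X)) μ}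
    with hF
  have hFfin : F.Finite := (Module.End.finite_hasEigenvalue _).insert 0
  obtain ⟨γ, hγ, hlt⟩ := MatrixFactorization.exists_neg_gt_of_finite
    ((hFfin.image2 (fun a b => √a - √b) hFfin).inter_of_left (Set.Iio 0)) fun d hd => hd.2
  refine ⟨γ, hγ, fun W S hM hWS => ?_⟩
  obtain ⟨a, ha, b, hb, hab, hle⟩ :=
    MatrixFactorization.exists_minEigenvalue_le_sqrt_sub_sqrt (sub_eq_zero.mp hM) hWS
  exact hle.trans_lt (hlt _ ⟨Set.mem_image2_of_mem ha (Or.inr hb), hab⟩)
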